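/- Let $X$ be a reduced complex space (of arbitrary dimension, possibly singular), let $n\in\mathbb N$, and let $A:X\to\mathrm{Mat}(n\times n,\mathbb C)$ be holomorphic. For $\Phi\in\mathrm{Mat}(n\times n,\mathbb C)$ let $\mathrm{Com}\,\Phi=\{\Theta\in\mathrm{Mat}(n\times n,\mathbb C) : \Phi\Theta=\Theta\Phi\}$. A point $\xi\in X$ is called Jordan stable for $A$ if there is an open neighborhood $U$ of $\xi$ such that (a) there are finitely many holomorphic functions $\lambda_1,\dots,\lambda_m:U\to\mathbb C$ such that, for each $\zeta\in U$, the numbers $\lambda_1(\zeta),\dots,\lambda_m(\zeta)$ are pairwise different and are precisely the eigenvalues of $A(\zeta)$; and (b) there is a holomorphic map $T:U\to\mathrm{GL}(n,\mathbb C)$ such that, for all $\zeta\in U$, $T(\zeta)^{-1}A(\zeta)T(\zeta)$ is in Jordan normal form (a block diagonal matrix of Jordan blocks, in any order). Let $\xi\in X$ be Jordan stable for $A$. Then there exist an open neighborhood $U$ of $\xi$ and a holomorphic map $H:U\to\mathrm{GL}(n,\mathbb C)$ such that $$H(\zeta)^{-1}\big(\mathrm{Com}\,A(\zeta)\big)H(\zeta)=\mathrm{Com}\,A(\xi)\quad\text{for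 all }\zeta\in U.$$ -/

import Mathlib

open scoped Topology

/-- A reduced complex space: a Hausdorff space `X` with a sheaf of complex-valued functions that is
locally isomorphic to a closed analytic subset `{z ∈ G | F₁ z = ⋯ = F_k z = 0}` of an open
set `G ⊆ ℂ^N`, endowed with the sheaf of local restrictions of holomorphic functions of `N` complex
variables (`N` may vary with the chart; singular points and arbitrary dimension are allowed).
The sheaf is given by its germs: `IsHolAt f x` says that the germ of `f` at `x` is holomorphic. -/
class ReducedComplexSpace (X : Type*) [TopologicalSpace X] extends T2Space X where
  /-- The germ of `f` at the point is a holomorphic function germ. -/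
  IsHolAt : (X → ℂ) → X → Prop
  /-- Around each point there is a chart `φ : U ≃ V` onto an analytic set `V` such that
  the holomorphic germs at points of `U` are the germs `g ∘ φ` with `g` holomorphic in the ambient
  space. In particular `IsHolAt` depends only on germs and is an open condition. -/
  exists_chart : ∀ x : X, ∃ (N k : ℕ) (U : Set X) (G : Set (Fin N → ℂ))
    (F : Fin k → (Fin N → ℂ) → ℂ) (φ : U ≃ₜ {z : Fin N → ℂ | z ∈ G ∧ ∀ i, F i z = 0}),
    IsOpen U ∧ x ∈ U ∧ IsOpen G ∧ (∀ i, AnalyticOnNhd ℂ (F i) G) ∧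
    ∀ (y : U) (f : X → ℂ), IsHolAt f y ↔
      ∃ g : (Fin N → ℂ) → ℂ, AnalyticAt ℂ g (φ y : Fin N → ℂ) ∧
        ∀ᶠ z : U in 𝓝 y, f z = g (φ z : Fin N → ℂ)

namespace ReducedComplexSpace

variable {X : Type*} [TopologicalSpace X] [ReducedComplexSpace X]

/-- `f` is holomorphic on `U` (used for open `U`; the values of `f` outside `U` play no role). -/
def HolOn (f : X → ℂ) (U : Set X) : Prop :=
  ∀ x ∈ U, IsHolAt f x

/-- A matrix-valued map is holomorphic on `U` if all its entries are. -/
def MatHolOn {n : ℕ} (M : X → Matrix (Fin n) (Fin n) ℂ) (U : Set X) : Prop :=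
  ∀ i j, HolOn (fun x => M x i j) U

end ReducedComplexSpace

/-- The `k × k` Jordan block with eigenvalue `μ`: `μ` on the diagonal, `1` on the superdiagonal. -/
def jordanBlock (k : ℕ) (μ : ℂ) : Matrix (Fin k) (Fin k) ℂ :=
  Matrix.of fun i j => if i = j then μ else if (i : ℕ) + 1 = (j : ℕ) then 1 else 0

/-- `J` is in Jordan normal form: it is the block diagonal matrix with Jordan blocks
`jordanBlock (s 0) (μ 0), …, jordanBlock (s (r - 1)) (μ (r - 1))` along the diagonal.
(`finSigmaFinEquiv` lists the indices of the blocks one block after the other.) -/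
def IsJordanNormalForm {n : ℕ} (J : Matrix (Fin n) (Fin n) ℂ) : Prop :=
  ∃ (r : ℕ) (s : Fin r → ℕ) (μ : Fin r → ℂ) (h : ∑ i, s i = n),
    (∀ i, 0 < s i) ∧
    J = Matrix.reindex (finSigmaFinEquiv.trans (finCongr h)) (finSigmaFinEquiv.trans (finCongr h))
      (Matrix.blockDiagonal' fun i => jordanBlock (s i) (μ i))

/-- `Com Φ`, the algebra of all matrices that commute with `Φ`. -/
def matrixCom {n : ℕ} (Φ : Matrix (Fin n) (Fin n) ℂ) : Subalgebra ℂ (Matrix (Fin n) (Fin n) ℂ) :=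
  Subalgebra.centralizer ℂ {Φ}

/-- `ξ` is Jordan stable for `A`: on some open neighborhood `U` of `ξ`,
(a) there are holomorphic functions `ev 0, …, ev (m - 1)` that are, at each point of `U`, pairwise
different and exactly the eigenvalues of `A`;
(b) there is a holomorphic `T : U → GL(n, ℂ)` such that `T⁻¹ A T` is in Jordan normal form at each
point of `U`. -/
def IsJordanStable {X : Type*} [TopologicalSpace X] [ReducedComplexSpace X] {n : ℕ}
    (A : X → Matrix (Fin n) (Fin n) ℂ) (ξ : X) : Prop :=
  ∃ U : Set X, IsOpen U ∧ ξ ∈ U ∧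
    (∃ (m : ℕ) (ev : Fin m → X → ℂ),
      (∀ j, ReducedComplexSpace.HolOn (ev j) U) ∧
      ∀ ζ ∈ U, Function.Injective (fun j => ev j ζ) ∧
        Set.range (fun j => ev j ζ) =
          {μ : ℂ | Module.End.HasEigenvalue (Matrix.toLin' (A ζ)) μ}) ∧
    ∃ T : X → GL (Fin n) ℂ,
      ReducedComplexSpace.MatHolOn (fun ζ => (T ζ : Matrix (Fin n) (Fin n) ℂ)) U ∧
      ∀ ζ ∈ U, IsJordanNormalForm
        ((((T ζ)⁻¹ : GL (Fin n) ℂ) : Matrix (Fin n) (Fin n) ℂ) * A ζ *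
          (T ζ : Matrix (Fin n) (Fin n) ℂ))

/-!
The neighborhood in (b) can be shrunk so that the commutant of the Jordan form `J = T⁻¹ A T` does
not change at all; then `H ζ = T ζ * (T ξ)⁻¹` conjugates `Com (A ζ)` onto `Com (A ξ)`.

Write `J ζ = D ζ + N ζ` with `D ζ` the diagonal part. Holomorphic functions are continuous, and the
entries of `N` take only the values `0` and `1`, so `N` is constant near `ξ`. The diagonal entries
of `J ζ` are eigenvalues of `A ζ`, and the eigenvalues are given by continuous, pairwise different
functions `ev j`; hence each diagonal entry coincides with one fixed `ev j` near `ξ`, and two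
diagonal entries agree at `ζ` exactly if they agree at `ξ` (`eventually_eq_iff_eq_of_mem_range`).

Finally, `N` is nilpotent and commutes with `D`, so a matrix commutes with `D + N` if and only if it
commutes with both `D` and `N` (`commute_diagonal_add_nilpotent_iff`). The commutant of `D` depends
only on which of its diagonal entries agree, and therefore `Com (J ζ) = Com (J ξ)`.
-/

open Matrix Filter

/-! ### Holomorphic functions on a reduced complex space -/

namespace ReducedComplexSpace

variable {X : Type*} [TopologicalSpace X] [ReducedComplexSpace X]

theorem IsHolAt.continuousAt {f : X → ℂ} {x : X} (hf : IsHolAt f x) : ContinuousAt f x := by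
  obtain ⟨N, k, U, G, F, φ, hU, hx, -, -, h⟩ := exists_chart x
  obtain ⟨g, hg, hfg⟩ := (h ⟨x, hx⟩ f).1 hf
  have hφ : ContinuousAt (fun z : U => (φ z : Fin N → ℂ)) ⟨x, hx⟩ :=
    (continuous_subtype_val.comp φ.continuous).continuousAt
  have hgφ : ContinuousAt (fun z : U => g (φ z : Fin N → ℂ)) ⟨x, hx⟩ :=
    ContinuousAt.comp (f := fun z : U => (φ z : Fin N → ℂ)) hg.continuousAt hφ
  have hfU : ContinuousAt (f ∘ ((↑) : U → X)) ⟨x, hx⟩ := hgφ.congr (hfg.mono fun z hz => hz.symm)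
  exact hU.isOpenEmbedding_subtypeVal.continuousAt_iff.1 hfU

theorem IsHolAt.sum_mul_const {ι : Type*} [Fintype ι] {f : ι → X → ℂ} {x : X}
    (hf : ∀ i, IsHolAt (f i) x) (c : ι → ℂ) : IsHolAt (fun z => ∑ i, f i z * c i) x := by
  obtain ⟨N, k, U, G, F, φ, -, hx, -, -, h⟩ := exists_chart x
  choose g hg hfg using fun i => (h ⟨x, hx⟩ (f i)).1 (hf i)
  refine (h ⟨x, hx⟩ _).2 ⟨fun w => ∑ i, g i w * c i, ?_, ?_⟩
  · exact Finset.analyticAt_fun_sum _ fun i _ => (hg i).mul analyticAt_const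
  · filter_upwards [eventually_all.2 hfg] with z hz
    exact Finset.sum_congr rfl fun i _ => by rw [hz i]

theorem MatHolOn.mul_const {n : ℕ} {M : X → Matrix (Fin n) (Fin n) ℂ} {U : Set X}
    (hM : MatHolOn M U) (C : Matrix (Fin n) (Fin n) ℂ) : MatHolOn (fun x => M x * C) U :=
  fun i j x hx => by
    simpa only [Matrix.mul_apply] using
      IsHolAt.sum_mul_const (fun k => hM i k x hx) fun k => C k j

theorem MatHolOn.continuousAt {n : ℕ} {M : X → Matrix (Fin n) (Fin n) ℂ} {U : Set X}
    (hM : MatHolOn M U) {x : X} (hx : x ∈ U) : ContinuousAt M x :=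
  continuousAt_pi.2 fun i => continuousAt_pi.2 fun j => (hM i j x hx).continuousAt

end ReducedComplexSpace

theorem continuousAt_coe_inv_GL {X : Type*} [TopologicalSpace X] {n : ℕ} {T : X → GL (Fin n) ℂ}
    {x : X} (hT : ContinuousAt (fun ζ => (T ζ : Matrix (Fin n) (Fin n) ℂ)) x) :
    ContinuousAt (fun ζ => (((T ζ)⁻¹ : GL (Fin n) ℂ) : Matrix (Fin n) (Fin n) ℂ)) x := by
  have hdet : ContinuousAt (fun ζ => (T ζ : Matrix (Fin n) (Fin n) ℂ).det) x :=
    (continuous_id.matrix_det).continuousAt.comp hT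
  have hadj : ContinuousAt (fun ζ => (T ζ : Matrix (Fin n) (Fin n) ℂ).adjugate) x :=
    (continuous_id.matrix_adjugate).continuousAt.comp hT
  have hne : (T x : Matrix (Fin n) (Fin n) ℂ).det ≠ 0 :=
    ((Matrix.isUnit_iff_isUnit_det _).1 (T x).isUnit).ne_zero
  simp only [Matrix.coe_units_inv, Matrix.inv_def, Ring.inverse_eq_inv']
  exact (hdet.inv₀ hne).smul hadj

/-! ### Functions with values in finitely many continuous branches -/

/-- A continuous function whose values are among those of pairwise different continuous functions
`ev j` follows a single one of these near `x`; so two such functions agree near `x` if and only if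
they agree at `x`. -/
theorem eventually_eq_iff_eq_of_mem_range {X : Type*} [TopologicalSpace X] {m : ℕ}
    {ev : Fin m → X → ℂ} {f g : X → ℂ} {x : X} (hev : ∀ j, ContinuousAt (ev j) x)
    (hf : ContinuousAt f x) (hg : ContinuousAt g x)
    (hinj : ∀ᶠ z in 𝓝 x, Function.Injective fun j => ev j z)
    (hfev : ∀ᶠ z in 𝓝 x, f z ∈ Set.range fun j => ev j z)
    (hgev : ∀ᶠ z in 𝓝 x, g z ∈ Set.range fun j => ev j z) :
    ∀ᶠ z in 𝓝 x, f z = g z ↔ f x = g x := by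
  have key : ∀ h : X → ℂ, ContinuousAt h x → (∀ᶠ z in 𝓝 x, h z ∈ Set.range fun j => ev j z) →
      ∃ j, ∀ᶠ z in 𝓝 x, h z = ev j z := by
    intro h hh hhev
    obtain ⟨j, hj⟩ := hhev.self_of_nhds
    refine ⟨j, ?_⟩
    have hne : ∀ᶠ z in 𝓝 x, ∀ k, k ≠ j → h z ≠ ev k z := by
      refine eventually_all.2 fun k => ?_
      by_cases hk : k = j
      · simp [hk]
      · have : h x ≠ ev k x := fun e => hk (hinj.self_of_nhds (e.symm.trans hj.symm))
        exact ((hh.ne_iff_eventually_ne (hev k)).1 this).mono fun z hz _ => hz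
    filter_upwards [hne, hhev] with z hz ⟨k, hk⟩
    by_cases hkj : k = j
    · rw [← hkj]; exact hk.symm
    · exact absurd hk.symm (hz k hkj)
  obtain ⟨j, hj⟩ := key f hf hfev
  obtain ⟨k, hk⟩ := key g hg hgev
  filter_upwards [hj, hk, hinj] with z hjz hkz hz
  rw [hjz, hkz, hj.self_of_nhds, hk.self_of_nhds]
  exact hz.eq_iff.trans hinj.self_of_nhds.eq_iff.symm

theorem eventually_eq_of_continuousAt_of_zero_or_one {X : Type*} [TopologicalSpace X] {f : X → ℂ}
    {x : X} (hf : ContinuousAt f x) (h01 : ∀ᶠ z in 𝓝 x, f z = 0 ∨ f z = 1) :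
    ∀ᶠ z in 𝓝 x, f z = f x := by
  rcases h01.self_of_nhds with h | h
  · filter_upwards [hf.eventually_ne (show f x ≠ 1 by simp [h]), h01] with z h1 h2
    rw [h]; exact h2.resolve_right h1
  · filter_upwards [hf.eventually_ne (show f x ≠ 0 by simp [h]), h01] with z h1 h2
    rw [h]; exact h2.resolve_left h1

/-! ### Commutants of matrices in Jordan normal form -/

theorem commute_diagonal_iff {n : ℕ} {d : Fin n → ℂ} {M : Matrix (Fin n) (Fin n) ℂ} :
    Commute (diagonal d) M ↔ ∀ i j, d i = d j ∨ M i j = 0 := by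
  rw [commute_iff_eq, ← Matrix.ext_iff]
  refine forall₂_congr fun i j => ?_
  rw [diagonal_mul, mul_diagonal, mul_comm, mul_eq_mul_left_iff]

/-- The diagonal part of `D + N` is its semisimple part in the Jordan–Chevalley decomposition, so it
commutes with everything that commutes with `D + N`. -/
theorem commute_diagonal_add_nilpotent_iff {n : ℕ} {d : Fin n → ℂ}
    {N M : Matrix (Fin n) (Fin n) ℂ} (hdN : Commute (diagonal d) N) (hN : IsNilpotent N) :
    Commute (diagonal d + N) M ↔ Commute (diagonal d) M ∧ Commute N M := by
  refine ⟨fun h => ?_, fun h => h.1.add_left h.2⟩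
  suffices hd : Commute (diagonal d) M from
    ⟨hd, by simpa using h.sub_left hd⟩
  -- On `M` the commuting operators `P = [D, ·]` and `Q = [-N, ·]` agree, hence so do their powers.
  -- The powers of the second one vanish eventually, and the first one multiplies the entry `(i, j)` by
  -- `d i - d j`.
  set P := LinearMap.mulLeft ℂ (diagonal d) - LinearMap.mulRight ℂ (diagonal d) with hP
  set Q := LinearMap.mulRight ℂ N - LinearMap.mulLeft ℂ N with hQ
  have hQnil : IsNilpotent Q :=
    (LinearMap.commute_mulLeft_right (R := ℂ) N N).symm.isNilpotent_sub
      ((LinearMap.isNilpotent_mulRight_iff ℂ N).2 hN) ((LinearMap.isNilpotent_mulLeft_iff ℂ N).2 hN)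
  have hPQ : Commute P Q := by
    refine LinearMap.ext fun Y => ?_
    simp only [hP, hQ, Module.End.mul_apply, LinearMap.sub_apply, LinearMap.mulLeft_apply,
      LinearMap.mulRight_apply, mul_sub, sub_mul, ← mul_assoc, hdN.eq]
    simp only [mul_assoc, hdN.eq]
    abel
  have hM : P M = Q M := by
    have h' := h.eq
    rw [add_mul, mul_add] at h'
    simp only [hP, hQ, LinearMap.sub_apply, LinearMap.mulLeft_apply, LinearMap.mulRight_apply]
    rw [sub_eq_sub_iff_add_eq_add, h', add_comm]
  have hpow : ∀ k, (P ^ k) M = (Q ^ k) M := by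
    intro k
    induction k with
    | zero => simp
    | succ k ih =>
      rw [pow_succ', Module.End.mul_apply, ih, ← Module.End.mul_apply, (hPQ.pow_right k).eq,
        Module.End.mul_apply, hM, ← Module.End.mul_apply, ← pow_succ]
  have hentry : ∀ k i j, ((P ^ k) M) i j = (d i - d j) ^ k * M i j := by
    intro k
    induction k with
    | zero => simp
    | succ k ih =>
      intro i j
      rw [pow_succ', Module.End.mul_apply, hP, LinearMap.sub_apply, LinearMap.mulLeft_apply,
        LinearMap.mulRight_apply, Matrix.sub_apply, diagonal_mul, mul_diagonal, ← hP, ih]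
      ring
  obtain ⟨k, hk⟩ := hQnil
  refine commute_diagonal_iff.2 fun i j => ?_
  have h0 := hentry k i j
  rw [hpow, hk] at h0
  rcases mul_eq_zero.1 h0.symm with h1 | h1
  · exact Or.inl (sub_eq_zero.1 (eq_zero_of_pow_eq_zero h1))
  · exact Or.inr h1

theorem isNilpotent_of_strictlyUpperTriangular {n : ℕ} {N : Matrix (Fin n) (Fin n) ℂ}
    (hN : ∀ i j, j ≤ i → N i j = 0) : IsNilpotent N := by
  have hc : N.charpoly = Polynomial.X ^ n := by
    rw [Matrix.charpoly_of_isUpperTriangular N fun i j hij => hN i j (le_of_lt hij)]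
    simp [hN]
  refine ⟨n, ?_⟩
  have := Matrix.aeval_self_charpoly N
  rwa [hc, map_pow, Polynomial.aeval_X] at this

namespace IsJordanNormalForm

variable {n : ℕ} {J : Matrix (Fin n) (Fin n) ℂ}

theorem eq_one_of_ne_zero (hJ : IsJordanNormalForm J) {i j : Fin n} (hij : i ≠ j)
    (h : J i j ≠ 0) : J i j = 1 ∧ i < j ∧ J i i = J j j := by
  obtain ⟨r, s, μ, hs, -, rfl⟩ := hJ
  set e := finSigmaFinEquiv.trans (finCongr hs) with he
  obtain ⟨⟨a, p⟩, rfl⟩ := e.surjective i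
  obtain ⟨⟨b, q⟩, rfl⟩ := e.surjective j
  simp only [reindex_apply, submatrix_apply, Equiv.symm_apply_apply] at h ⊢
  by_cases hab : a = b
  · subst hab
    have hpq : p ≠ q := by rintro rfl; exact hij rfl
    simp only [blockDiagonal'_apply_eq, jordanBlock, of_apply, if_neg hpq, if_true] at h ⊢
    have h1 : (p : ℕ) + 1 = q := by
      by_contra hc
      exact h (if_neg hc)
    refine ⟨if_pos h1, ?_, trivial⟩
    rw [Fin.lt_def]
    simp only [he, Equiv.trans_apply, finCongr_apply, Fin.val_cast, finSigmaFinEquiv_apply]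
    omega
  · exact absurd (blockDiagonal'_apply_ne _ _ _ hab) h

theorem zero_or_one (hJ : IsJordanNormalForm J) {i j : Fin n} (hij : i ≠ j) :
    J i j = 0 ∨ J i j = 1 :=
  or_iff_not_imp_left.2 fun h => (hJ.eq_one_of_ne_zero hij h).1

theorem apply_eq_zero (hJ : IsJordanNormalForm J) {i j : Fin n} (hij : j < i) : J i j = 0 := by
  by_contra h
  exact lt_asymm hij (hJ.eq_one_of_ne_zero hij.ne' h).2.1

/-- The commutant of `J` is determined by its off-diagonal part and by the pattern of equalities
among its diagonal entries. -/
theorem commute_iff (hJ : IsJordanNormalForm J) {M : Matrix (Fin n) (Fin n) ℂ} :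
    Commute J M ↔
      (∀ i j, J i i = J j j ∨ M i j = 0) ∧ Commute (J - diagonal fun i => J i i) M := by
  have hN : ∀ i j, i ≠ j → (J - diagonal fun i => J i i) i j = J i j := fun i j hij => by
    simp [hij]
  have hnil : IsNilpotent (J - diagonal fun i => J i i) := by
    refine isNilpotent_of_strictlyUpperTriangular fun i j hij => ?_
    rcases hij.eq_or_lt with rfl | hij
    · simp
    · rw [hN i j hij.ne', hJ.apply_eq_zero hij]
  have hcomm : Commute (diagonal fun i => J i i) (J - diagonal fun i => J i i) := by
    refine commute_diagonal_iff.2 fun i j => ?_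
    by_cases hij : i = j
    · exact Or.inl (by rw [hij])
    · rw [hN i j hij]
      by_cases h : J i j = 0
      · exact Or.inr h
      · exact Or.inl (hJ.eq_one_of_ne_zero hij h).2.2
  rw [← commute_diagonal_iff (d := fun i => J i i), ← commute_diagonal_add_nilpotent_iff hcomm hnil,
    add_sub_cancel]

theorem hasEigenvalue (hJ : IsJordanNormalForm J) (i : Fin n) :
    Module.End.HasEigenvalue (Matrix.toLin' J) (J i i) := by
  rw [Module.End.hasEigenvalue_iff_mem_spectrum, Matrix.spectrum_toLin',
    Matrix.mem_spectrum_iff_isRoot_charpoly,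
    Matrix.charpoly_of_isUpperTriangular J fun i j hij => hJ.apply_eq_zero hij]
  rw [Polynomial.IsRoot.def, Polynomial.eval_prod]
  exact Finset.prod_eq_zero (Finset.mem_univ i) (by simp)

end IsJordanNormalForm

/-! ### Conjugation of eigenvalues and commutants -/

theorem hasEigenvalue_toLin'_units_conj {n : ℕ} (P : GL (Fin n) ℂ) (M : Matrix (Fin n) (Fin n) ℂ)
    (μ : ℂ) : Module.End.HasEigenvalue
        (Matrix.toLin' (((P⁻¹ : GL (Fin n) ℂ) : Matrix (Fin n) (Fin n) ℂ) * M *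
          (P : Matrix (Fin n) (Fin n) ℂ))) μ ↔
      Module.End.HasEigenvalue (Matrix.toLin' M) μ := by
  simp only [Module.End.hasEigenvalue_iff_mem_spectrum, Matrix.spectrum_toLin',
    spectrum.units_conjugate']

theorem mem_matrixCom {n : ℕ} {Φ M : Matrix (Fin n) (Fin n) ℂ} :
    M ∈ matrixCom Φ ↔ Commute Φ M := by
  simp [matrixCom, Subalgebra.mem_centralizer_iff, commute_iff_eq]

theorem commute_units_conj_iff {R : Type*} [Monoid R] (P : Rˣ) (a b : R) :
    Commute (↑P⁻¹ * a * P) (↑P⁻¹ * b * P) ↔ Commute a b := by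
  have h : ∀ x y : R, (↑P⁻¹ * x * P) * (↑P⁻¹ * y * P) = ↑P⁻¹ * (x * y) * P := fun x y => by
    simp only [mul_assoc, Units.mul_inv_cancel_left]
  rw [commute_iff_eq, commute_iff_eq, h, h, Units.mul_left_inj, Units.mul_right_inj]

theorem theorem6p3 {X : Type*} [TopologicalSpace X] [ReducedComplexSpace X] (n : ℕ)
    (A : X → Matrix (Fin n) (Fin n) ℂ) (hA : ReducedComplexSpace.MatHolOn A Set.univ)
    (ξ : X) (hξ : IsJordanStable A ξ) :
    ∃ U : Set X, IsOpen U ∧ ξ ∈ U ∧ ∃ H : X → GL (Fin n) ℂ,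
      ReducedComplexSpace.MatHolOn (fun ζ => (H ζ : Matrix (Fin n) (Fin n) ℂ)) U ∧
      ∀ ζ ∈ U,
        (fun Θ : Matrix (Fin n) (Fin n) ℂ =>
            (((H ζ)⁻¹ : GL (Fin n) ℂ) : Matrix (Fin n) (Fin n) ℂ) * Θ *
              (H ζ : Matrix (Fin n) (Fin n) ℂ)) ''
          (matrixCom (A ζ) : Set (Matrix (Fin n) (Fin n) ℂ)) =
        (matrixCom (A ξ) : Set (Matrix (Fin n) (Fin n) ℂ)) := by
  obtain ⟨U, hU, hξU, ⟨m, ev, hev, hspec⟩, T, hT, hJ⟩ := hξ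
  set J : X → Matrix (Fin n) (Fin n) ℂ := fun ζ =>
    (((T ζ)⁻¹ : GL (Fin n) ℂ) : Matrix (Fin n) (Fin n) ℂ) * A ζ *
      (T ζ : Matrix (Fin n) (Fin n) ℂ)
  have hJcont : ContinuousAt J ξ :=
    ((continuousAt_coe_inv_GL (hT.continuousAt hξU)).mul
      (hA.continuousAt (Set.mem_univ ξ))).mul (hT.continuousAt hξU)
  have hentry : ∀ i j, ContinuousAt (fun ζ => J ζ i j) ξ := fun i j =>
    continuousAt_pi.1 (continuousAt_pi.1 hJcont i) j
  have hUξ : ∀ᶠ ζ in 𝓝 ξ, ζ ∈ U := hU.mem_nhds hξU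
  have hoff : ∀ᶠ ζ in 𝓝 ξ, ∀ i j, i ≠ j → J ζ i j = J ξ i j := by
    refine eventually_all.2 fun i => eventually_all.2 fun j => ?_
    by_cases hij : i = j
    · simp [hij]
    · have h01 : ∀ᶠ ζ in 𝓝 ξ, J ζ i j = 0 ∨ J ζ i j = 1 :=
        hUξ.mono fun ζ hζ => (hJ ζ hζ).zero_or_one hij
      exact (eventually_eq_of_continuousAt_of_zero_or_one (hentry i j) h01).mono fun ζ hζ _ => hζ
  have hmem : ∀ i, ∀ᶠ ζ in 𝓝 ξ, J ζ i i ∈ Set.range fun j => ev j ζ := fun i => by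
    filter_upwards [hUξ] with ζ hζ
    rw [(hspec ζ hζ).2]
    exact (hasEigenvalue_toLin'_units_conj (T ζ) (A ζ) _).1 ((hJ ζ hζ).hasEigenvalue i)
  have hdiag : ∀ᶠ ζ in 𝓝 ξ, ∀ i j, J ζ i i = J ζ j j ↔ J ξ i i = J ξ j j :=
    eventually_all.2 fun i => eventually_all.2 fun j =>
      eventually_eq_iff_eq_of_mem_range (fun k => (hev k ξ hξU).continuousAt) (hentry i i)
        (hentry j j) (hUξ.mono fun ζ hζ => (hspec ζ hζ).1) (hmem i) (hmem j)
  obtain ⟨V, hV, hVopen, hξV⟩ := mem_nhds_iff.1 (hUξ.and (hoff.and hdiag))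
  have hcom : ∀ ζ ∈ V, ∀ M, Commute (J ζ) M ↔ Commute (J ξ) M := by
    intro ζ hζ M
    obtain ⟨hζU, hζoff, hζdiag⟩ := hV hζ
    have hN : J ζ - diagonal (fun i => J ζ i i) = J ξ - diagonal (fun i => J ξ i i) := by
      ext i j
      by_cases hij : i = j
      · simp [hij]
      · simp [hij, hζoff i j hij]
    rw [(hJ ζ hζU).commute_iff, (hJ ξ hξU).commute_iff, hN]
    exact and_congr_left' (forall₂_congr fun i j => or_congr_left (hζdiag i j))
  refine ⟨V, hVopen, hξV, fun ζ => T ζ * (T ξ)⁻¹, ?_, fun ζ hζ => ?_⟩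
  · intro i j ζ hζ
    exact hT.mul_const (((T ξ)⁻¹ : GL (Fin n) ℂ) : Matrix (Fin n) (Fin n) ℂ) i j ζ (hV hζ).1
  · have hiff : ∀ M, Commute (A ζ) M ↔
        Commute (A ξ) ((((T ζ * (T ξ)⁻¹)⁻¹ : GL (Fin n) ℂ) : Matrix (Fin n) (Fin n) ℂ) * M *
          ((T ζ * (T ξ)⁻¹ : GL (Fin n) ℂ) : Matrix (Fin n) (Fin n) ℂ)) := by
      intro M
      rw [← commute_units_conj_iff (T ζ) (A ζ) M, ← commute_units_conj_iff (T ξ) (A ξ)]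
      refine (hcom ζ hζ _).trans (Eq.to_iff ?_)
      congr 1
      simp [mul_assoc]
    ext M
    simp only [Set.mem_image, SetLike.mem_coe, mem_matrixCom]
    constructor
    · rintro ⟨Θ, hΘ, rfl⟩
      exact (hiff Θ).1 hΘ
    · intro hM
      refine ⟨((T ζ * (T ξ)⁻¹ : GL (Fin n) ℂ) : Matrix (Fin n) (Fin n) ℂ) * M *
        (((T ζ * (T ξ)⁻¹)⁻¹ : GL (Fin n) ℂ) : Matrix (Fin n) (Fin n) ℂ), (hiff _).2 ?_, ?_⟩
      · convert hM using 1
        simp only [mul_assoc, Units.inv_mul_cancel_left, Units.inv_mul, mul_one]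
      · simp only [mul_assoc, Units.inv_mul_cancel_left, Units.inv_mul, mul_one]
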